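/- **Setting.** An atom $R(t_1,\dots,t_n)$ has a predicate $R$ and a tuple of terms (constants, labeled nulls or variables). A database $D$ is a finite set of atoms over constants. A linear TGD is a constant-free sentence $\sigma = R(\bar x)\rightarrow\exists\bar z\,\psi(\bar y,\bar z)$ with one body atom $R(\bar x)$, with $\bar y\subseteq\bar x$, $\bar z$ disjoint from $\bar x$, and with $\psi$ a non-empty finite conjunction (set) of head atoms; the frontier $\mathrm{fr}(\sigma)$ is the set of variables that occur both in the body and in the head. Let $\Sigma$ be a finite set of linear TGDs. **Chase.** A trigger on a set $I$ of atoms over constants and nulls is a pair $(\sigma,h)$ with $\sigma\in\Sigma$ and $h$ a map on $\bar x$ with $R(h(\bar x))\in I$. Its result is the image of the head under $\mu$, where $\mu(x)=h(x)$ for $x\in\mathrm{fr}(\sigma)$ and $\mu(x)$ is the null $\bot^{x}_{\sigma,h|_{\mathrm{fr}(\sigma)}}$, uniquely determined by $\sigma$, $h|_{\mathrm{fr}(\sigma)}$ and $x$, for the other head variables. Put $\mathsf{chase}^0(D,\Sigma)=D$, let $\mathsf{chase}^{i+1}(D,\Sigma)$ be $\mathsf{chase}^{i}(D,\Sigma)$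 together with the results of all triggers on it, and let $\mathsf{chase}(D,\Sigma)=\bigcup_{i\ge 0}\mathsf{chase}^i(D,\Sigma)$ (the semi-oblivious chase). **Simplification.** For a tuple $\bar t$, $\mathsf{unique}(\bar t)$ keeps only the first occurrence of each term, and $\mathsf{id}(\bar t)$ replaces each term by its position (from 1) in $\mathsf{unique}(\bar t)$. The shape of $R(\bar t)$ is the predicate $R_{\mathsf{id}(\bar t)}$, and $\mathsf{simple}(R(\bar t))=R_{\mathsf{id}(\bar t)}(\mathsf{unique}(\bar t))$. For a set $S$ of shapes, $DB[S]=\{R(\mathsf{id}(\bar t)) : R_{\mathsf{id}(\bar t)}\in S\}$. If $h$ is a homomorphism from $R(\bar x)$ to $DB[S]$, the $h$-specialization of $\bar x$ is the function $f$ that maps each variable of $\bar x$ to the first variable of $\bar x$ with the same $h$-value, and the simplification of $\sigma$ induced by $f$ is $\mathsf{simple}(R(f(\bar x)))\rightarrow\exists\bar z\,\mathsf{simple}(\psi(f(\bar y),\bar z))$. Let $\mathsf{Applicable}(S,\Sigma)$ be the set of these simplified TGDs for all $\sigma\in\Sigma$ and all homomorphisms $h$ from the body of $\sigma$ to $DB[S]$.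 Let $\mathsf{shape}(\Sigma)$ be the set of all shapes of atoms whose predicate occurs in $\Sigma$. **Algorithm.** $\mathsf{DynSimplification}(D,\Sigma)$: let $S$ be the set of shapes of the atoms of $D$, $\Sigma_s=\emptyset$ and $\Delta S=S$. While $\Delta S\ne\emptyset$: let $\Sigma_{aux}=\mathsf{Applicable}(\Delta S,\Sigma)$, let $S_{aux}$ be the set of shapes in $\mathsf{shape}(\Sigma)$ that occur as a predicate in the head of a TGD of $\Sigma_{aux}$, and set $\Sigma_s\leftarrow\Sigma_s\cup\Sigma_{aux}$, $\Delta S\leftarrow S_{aux}\setminus S$, $S\leftarrow S\cup\Delta S$. Return $\Sigma_s$. The dependency graph of $\Sigma_s$ has as nodes the positions $(P,i)$ of the predicates $P$ of $\Sigma_s$. For each $\sigma\in\Sigma_s$, each $x\in\mathrm{fr}(\sigma)$ and each position $\pi$ of $x$ in the body of $\sigma$, there are a normal edge from $\pi$ to every position of $x$ in a head atom of $\sigma$, and a special edge from $\pi$ to every position in a head atom of $\sigma$ of an existentially quantified variable of $\sigma$. A special SCC is a strongly connected component (a maximal subgraph with a directed path between every pair of nodes) that contains a special edge. $\mathsf{IsChaseFinite[L]}(D,\Sigma)$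 computes $\Sigma_s=\mathsf{DynSimplification}(D,\Sigma)$ and its dependency graph, and returns $\mathtt{false}$ if this graph has a special SCC, and $\mathtt{true}$ otherwise. **Lemma.** For every database $D$ and every finite set $\Sigma$ of linear TGDs, $\mathsf{IsChaseFinite[L]}(D,\Sigma)=\mathtt{true}$ if and only if $\mathsf{chase}(D,\Sigma)$ is finite. -/

import Mathlib

namespace Chase

/-! ### Atoms, linear TGDs -/

/-- An atom `R(t₁,…,tₙ)` over predicate symbols `P` and terms `T`; its arity is the number of its
arguments. Predicates with a fixed arity are the special case in which all atoms with the same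
predicate have the same number of arguments. -/
@[ext]
structure Atom (P T : Type*) where
  pred : P
  args : List T
deriving DecidableEq

/-- Application of a substitution to an atom. -/
def Atom.map {P T T' : Type*} (h : T → T') (α : Atom P T) : Atom P T' :=
  ⟨α.pred, α.args.map h⟩

/-- The set of terms (in a TGD: variables) of an atom. -/
def Atom.vars {P V : Type*} [DecidableEq V] (α : Atom P V) : Finset V :=
  α.args.toFinset

/-- A (constant-free) linear TGD `R(x̄) → ∃ z̄ ψ(ȳ, z̄)`: one body atom and a non-empty finite
conjunction of head atoms, all over variables. The existentially quantified variables are those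
head variables which do not occur in the body. -/
@[ext]
structure LinearTGD (P V : Type*) where
  body : Atom P V
  head : Finset (Atom P V)
  head_nonempty : head.Nonempty
deriving DecidableEq

section TGD

variable {P V : Type*} [DecidableEq V]

/-- The variables of the head. -/
def LinearTGD.headVars (σ : LinearTGD P V) : Finset V :=
  σ.head.biUnion Atom.vars

/-- The frontier: the variables occurring both in the body and in the head. -/
def LinearTGD.frontier (σ : LinearTGD P V) : Finset V :=
  σ.body.vars ∩ σ.headVars

/-- The existentially quantified variables. -/
def LinearTGD.exVars (σ : LinearTGD P V) : Finset V :=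
  σ.headVars \ σ.body.vars

end TGD

/-! ### The semi-oblivious chase -/

/-- The terms of instances: constants, and labeled nulls `⊥^x_{σ, h|fr(σ)}`, each of which is
uniquely determined by the TGD `σ`, the restriction of the trigger homomorphism `h` to the frontier
of `σ`, and the variable `x`. -/
inductive GTerm (C P V : Type*) [DecidableEq V] where
  | const (c : C) : GTerm C P V
  | null (σ : LinearTGD P V) (h : {v : V // v ∈ σ.frontier} → GTerm C P V) (x : V) : GTerm C P V

section SemiOblivious

variable {C P V : Type*} [DecidableEq V]

/-- The pair `(σ, h)` is a trigger on `I` if `h` is a homomorphism from `body(σ)` to `I`. Only the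
values of `h` on the variables of the body matter. -/
def IsTrigger (Γ : Set (LinearTGD P V)) (I : Set (Atom P (GTerm C P V)))
    (σ : LinearTGD P V) (h : V → GTerm C P V) : Prop :=
  σ ∈ Γ ∧ σ.body.map h ∈ I

/-- The assignment `μ` of the head variables used by the trigger `(σ, h)`. -/
def headAssignment (σ : LinearTGD P V) (h : V → GTerm C P V) (x : V) : GTerm C P V :=
  if x ∈ σ.frontier then h x else GTerm.null σ (fun v => h v.1) x

/-- The result of a trigger: the set `μ(head(σ))`. -/
def result (σ : LinearTGD P V) (h : V → GTerm C P V) : Set (Atom P (GTerm C P V)) :=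
  {β | ∃ α ∈ σ.head, β = α.map (headAssignment σ h)}

/-- The instance `chaseⁱ(D, Γ)`; a database is a finite set of facts (atoms over constants). -/
def chaseStage (D : Finset (Atom P C)) (Γ : Finset (LinearTGD P V)) :
    ℕ → Set (Atom P (GTerm C P V))
  | 0 => {β | ∃ α ∈ D, β = α.map GTerm.const}
  | i + 1 => chaseStage D Γ i ∪
      {β | ∃ σ h, IsTrigger (Γ : Set (LinearTGD P V)) (chaseStage D Γ i) σ h ∧ β ∈ result σ h}

/-- The result `chase(D, Γ)` of the semi-oblivious chase. -/
def chase (D : Finset (Atom P C)) (Γ : Finset (LinearTGD P V)) : Set (Atom P (GTerm C P V)) :=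
  ⋃ i, chaseStage D Γ i

end SemiOblivious

/-! ### Shapes and simplification -/

/-- The tuple `unique(t̄)`: keep only the first occurrence of each term. -/
def unique {T : Type*} [DecidableEq T] : List T → List T
  | [] => []
  | t :: l => t :: (unique l).filter (fun s => s ≠ t)

/-- The tuple `id(t̄)`: each term is replaced by its position (counted from 1) in `unique(t̄)`. -/
def idTuple {T : Type*} [DecidableEq T] (l : List T) : List ℕ :=
  l.map (fun t => (unique l).idxOf t + 1)

/-- The predicate symbols `R_{id}` used for simplification. -/
@[ext]
structure Shape (P : Type*) where
  pred : P
  id : List ℕ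
deriving DecidableEq

/-- The shape `R_{id(t̄)}` of an atom `R(t̄)`. -/
def Atom.shape {P T : Type*} [DecidableEq T] (α : Atom P T) : Shape P :=
  ⟨α.pred, idTuple α.args⟩

/-- The simplification `R_{id(t̄)}(unique(t̄))` of an atom `R(t̄)`. -/
def Atom.simple {P T : Type*} [DecidableEq T] (α : Atom P T) : Atom (Shape P) T :=
  ⟨α.shape, unique α.args⟩

/-- The atom `R(id(t̄))` of the induced database corresponding to the shape `R_{id(t̄)}`. -/
def Shape.toAtom {P : Type*} (s : Shape P) : Atom P ℕ :=
  ⟨s.pred, s.id⟩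

/-- The database `DB[S]` induced by a set of shapes; here the integers serve as constants. -/
def inducedDB {P : Type*} [DecidableEq P] (S : Finset (Shape P)) : Finset (Atom P ℕ) :=
  S.image Shape.toAtom

section Simplification

variable {P V : Type*} [DecidableEq P] [DecidableEq V]

/-- `f` is a specialization of the tuple `x̄`: `f(x₁) = x₁` and
`f(xᵢ) ∈ {f(x₁), …, f(xᵢ₋₁), xᵢ}` for the later `i`. As `f` is a function on the variables of `x̄`
only, it is extended to all other variables by the identity. -/
def IsSpecialization (x : List V) (f : V → V) : Prop :=
  (∀ i (hi : i < x.length), f x[i] = x[i] ∨ ∃ j, ∃ hj : j < i, f x[i] = f (x[j]'(hj.trans hi))) ∧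
    ∀ v, v ∉ x → f v = v

/-- The `h`-specialization of `x̄`: a variable of `x̄` is mapped to the first variable of `x̄` which
has the same value under `h`. -/
def hSpecialization {T : Type*} [DecidableEq T] (x : List V) (h : V → T) (v : V) : V :=
  if v ∈ x then (x.find? (fun w => h w = h v)).getD v else v

/-- The `h`-specialization of `x̄` is a specialization of `x̄`. -/
theorem isSpecialization_hSpecialization {T : Type*} [DecidableEq T] (x : List V) (h : V → T) :
    IsSpecialization x (hSpecialization x h) := by
  refine ⟨fun i hi => ?_, fun v hv => by simp [hSpecialization, hv]⟩
  obtain ⟨w, hw⟩ : ∃ w, x.find? (fun w => h w = h x[i]) = some w :=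
    Option.isSome_iff_exists.mp (List.find?_isSome.mpr ⟨x[i], List.getElem_mem hi, decide_eq_true rfl⟩)
  have hf : hSpecialization x h x[i] = w := by simp [hSpecialization, hw]
  obtain ⟨hpw, j, hj, hjw, hmin⟩ := List.find?_eq_some_iff_getElem.mp hw
  have hhw : h w = h x[i] := by simpa using hpw
  rcases lt_trichotomy j i with hji | hji | hji
  · refine Or.inr ⟨j, hji, ?_⟩
    rw [hf, hjw]
    have hwx : w ∈ x := hjw ▸ List.getElem_mem hj
    simp [hSpecialization, hwx, hhw, hw]
  · subst hji
    exact Or.inl (hf.trans hjw.symm)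
  · have := hmin i hji
    simp at this

/-- On the variables of `x̄`, the `h`-specialization identifies exactly what `h` identifies. -/
theorem hSpecialization_eq_iff {T : Type*} [DecidableEq T] {x : List V} (h : V → T) {v w : V}
    (hv : v ∈ x) (hw : w ∈ x) :
    hSpecialization x h v = hSpecialization x h w ↔ h v = h w := by
  have key : ∀ u ∈ x, h (hSpecialization x h u) = h u := by
    intro u hu
    obtain ⟨r, hr⟩ : ∃ r, x.find? (fun w => h w = h u) = some r :=
      Option.isSome_iff_exists.mp (List.find?_isSome.mpr ⟨u, hu, decide_eq_true rfl⟩)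
    have := List.find?_some hr
    simpa [hSpecialization, hu, hr] using this
  constructor
  · intro he
    rw [← key v hv, ← key w hw, he]
  · intro he
    obtain ⟨r, hr⟩ : ∃ r, x.find? (fun u => h u = h w) = some r :=
      Option.isSome_iff_exists.mp (List.find?_isSome.mpr ⟨w, hw, decide_eq_true rfl⟩)
    simp [hSpecialization, hv, hw, he, hr]

/-- There is at most one specialization of `x̄` with given identifications. -/
theorem IsSpecialization.unique {x : List V} {f g : V → V} (hf : IsSpecialization x f)
    (hg : IsSpecialization x g)
    (h : ∀ v ∈ x, ∀ w ∈ x, f v = f w ↔ g v = g w) : f = g := by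
  have main : ∀ i (hi : i < x.length), f x[i] = g x[i] := by
    intro i
    induction i using Nat.strong_induction_on with
    | _ i ih =>
      intro hi
      rcases hf.1 i hi with h1 | ⟨j, hj, h1⟩
      · rcases hg.1 i hi with h2 | ⟨j, hj, h2⟩
        · rw [h1, h2]
        · have hj' := hj.trans hi
          rw [h2, (h _ (List.getElem_mem hi) _ (List.getElem_mem hj')).mpr h2, ih j hj hj']
      · have hj' := hj.trans hi
        rw [h1, (h _ (List.getElem_mem hi) _ (List.getElem_mem hj')).mp h1, ih j hj hj']
  funext v
  by_cases hv : v ∈ x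
  · obtain ⟨i, hi, rfl⟩ := List.getElem_of_mem hv
    exact main i hi
  · rw [hf.2 v hv, hg.2 v hv]

/-- The simplification of a linear TGD induced by a specialization `f` of its body variables. -/
def LinearTGD.simplify (σ : LinearTGD P V) (f : V → V) : LinearTGD (Shape P) V where
  body := (σ.body.map f).simple
  head := σ.head.image (fun α => (α.map f).simple)
  head_nonempty := σ.head_nonempty.image _

/-- The only candidate (on the variables of `α`) for a homomorphism from `{α}` to `{β}`. -/
def candidateHom (α : Atom P V) (β : Atom P ℕ) (v : V) : ℕ :=
  β.args.getD (α.args.idxOf v) 0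

/-- The set of all simplifications of TGDs `σ` of `Γ` induced by the `h`-specialization of the body
variables, for a homomorphism `h` from the body of `σ` to `DB[S]`. -/
def applicable (S : Finset (Shape P)) (Γ : Finset (LinearTGD P V)) :
    Finset (LinearTGD (Shape P) V) :=
  Γ.biUnion fun σ =>
    ((inducedDB S).filter (fun β => σ.body.map (candidateHom σ.body β) = β)).image
      (fun β => σ.simplify (hSpecialization σ.body.args (candidateHom σ.body β)))

/-- The set `applicable S Γ` in terms of arbitrary homomorphisms from body atoms to `DB[S]`. -/
theorem mem_applicable {S : Finset (Shape P)} {Γ : Finset (LinearTGD P V)}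
    {τ : LinearTGD (Shape P) V} :
    τ ∈ applicable S Γ ↔ ∃ σ ∈ Γ, ∃ h : V → ℕ, σ.body.map h ∈ inducedDB S ∧
      τ = σ.simplify (hSpecialization σ.body.args h) := by
  simp only [applicable, Finset.mem_biUnion, Finset.mem_image, Finset.mem_filter]
  constructor
  · rintro ⟨σ, hσ, β, ⟨hβ, hm⟩, rfl⟩
    exact ⟨σ, hσ, candidateHom σ.body β, hm.symm ▸ hβ, rfl⟩
  · rintro ⟨σ, hσ, h, hh, rfl⟩
    have hc : ∀ v ∈ σ.body.args, candidateHom σ.body (σ.body.map h) v = h v := by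
      intro v hv
      have hlt := List.idxOf_lt_length_of_mem hv
      simp [candidateHom, Atom.map, List.getD_eq_getElem?_getD, hlt]
    refine ⟨σ, hσ, σ.body.map h, ⟨hh, ?_⟩, ?_⟩
    · exact Atom.ext rfl (List.map_congr_left hc)
    · congr 1
      refine (isSpecialization_hSpecialization _ _).unique
        (isSpecialization_hSpecialization _ _) fun v hv w hw => ?_
      rw [hSpecialization_eq_iff _ hv hw, hSpecialization_eq_iff _ hv hw, hc v hv, hc w hw]

end Simplification

/-! ### Schemas and dynamic simplification -/

section Schema

variable {P V : Type*} [DecidableEq P] [DecidableEq V]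

/-- The atoms occurring in a set of TGDs. -/
def atomsOf (Γ : Finset (LinearTGD P V)) : Finset (Atom P V) :=
  Γ.biUnion (fun σ => insert σ.body σ.head)

/-- The schema `sch(Γ)`: the predicates (with their arity) occurring in `Γ`. -/
def sch (Γ : Finset (LinearTGD P V)) : Finset (P × ℕ) :=
  (atomsOf Γ).image (fun α => (α.pred, α.args.length))

/-- The set of all shapes of atoms with a predicate of the schema `Sch`; as a tuple of length `n` has
at most `n` distinct terms, it suffices to consider tuples over an `n`-element set of terms. -/
def shapesOfSchema (Sch : Finset (P × ℕ)) : Finset (Shape P) :=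
  Sch.biUnion fun R =>
    (Finset.univ : Finset (Fin R.2 → Fin R.2)).image
      (fun t => (⟨R.1, List.ofFn t⟩ : Atom P (Fin R.2)).shape)

/-- The set `shape(D)` of the shapes of the atoms of the database `D`. -/
def findShapes {C : Type*} [DecidableEq C] (D : Finset (Atom P C)) : Finset (Shape P) :=
  D.image Atom.shape

/-- The shapes over `sch(Γ)` occurring in the head of some TGD of `Γaux`. -/
def headShapes (Γ : Finset (LinearTGD P V)) (Γaux : Finset (LinearTGD (Shape P) V)) :
    Finset (Shape P) :=
  (shapesOfSchema (sch Γ)).filter (fun s => ∃ σ ∈ Γaux, ∃ α ∈ σ.head, α.pred = s)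

/-- The while-loop of dynamic simplification, with state `(S, ΔS, Γs)`. -/
def dynLoop (Γ : Finset (LinearTGD P V)) (S ΔS : Finset (Shape P))
    (Γs : Finset (LinearTGD (Shape P) V)) : Finset (LinearTGD (Shape P) V) :=
  if ΔS = ∅ then Γs
  else
    let Γaux := applicable ΔS Γ
    let ΔS' := headShapes Γ Γaux \ S
    dynLoop Γ (S ∪ ΔS') ΔS' (Γs ∪ Γaux)
termination_by 2 * (shapesOfSchema (sch Γ) \ S).card + (if ΔS = ∅ then 0 else 1)
decreasing_by
  rename_i hne
  rw [if_neg hne]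
  by_cases h0 : headShapes Γ (applicable ΔS Γ) \ S = ∅
  · simp only [h0, Finset.union_empty, if_true]
    omega
  · rw [if_neg h0]
    have hlt : (shapesOfSchema (sch Γ) \ (S ∪ (headShapes Γ (applicable ΔS Γ) \ S))).card
        < (shapesOfSchema (sch Γ) \ S).card := by
      apply Finset.card_lt_card
      obtain ⟨s, hs⟩ := Finset.nonempty_iff_ne_empty.mpr h0
      have hs' := Finset.mem_sdiff.mp hs
      have hU : s ∈ shapesOfSchema (sch Γ) := (Finset.mem_filter.mp hs'.1).1
      refine Finset.ssubset_iff_of_subset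
        (Finset.sdiff_subset_sdiff (Finset.Subset.refl _) Finset.subset_union_left) |>.mpr
        ⟨s, Finset.mem_sdiff.mpr ⟨hU, hs'.2⟩, fun hc => ?_⟩
      exact (Finset.mem_sdiff.mp hc).2 (Finset.mem_union_right _ hs)
    omega

/-- The algorithm `DynSimplification`. -/
def dynSimplification {C : Type*} [DecidableEq C] (D : Finset (Atom P C))
    (Γ : Finset (LinearTGD P V)) : Finset (LinearTGD (Shape P) V) :=
  dynLoop Γ (findShapes D) (findShapes D) ∅

end Schema

/-! ### Dependency graphs and strongly connected components -/

/-- A finite directed multigraph with normal and special edges. -/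
structure DepGraph (N : Type*) where
  nodes : Finset N
  normal : Finset (N × N)
  special : Finset (N × N)

section BuildGraph

variable {P V : Type*} [DecidableEq P] [DecidableEq V]

/-- The positions `(R, i)` of a schema; arguments are counted from 0. -/
def positions (Sch : Finset (P × ℕ)) : Finset (P × ℕ) :=
  Sch.biUnion (fun R => (Finset.range R.2).image (fun i => (R.1, i)))

/-- The positions of an atom at which the variable `x` occurs. -/
def Atom.posVar (α : Atom P V) (x : V) : Finset (P × ℕ) :=
  ((Finset.range α.args.length).filter (fun i => α.args[i]? = some x)).image
    (fun i => (α.pred, i))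

/-- The positions of a set of atoms at which the variable `x` occurs. -/
def posVarSet (A : Finset (Atom P V)) (x : V) : Finset (P × ℕ) :=
  A.biUnion (fun α => α.posVar x)

/-- The dependency graph of a set of linear TGDs. -/
def buildDepGraph (Γ : Finset (LinearTGD P V)) : DepGraph (P × ℕ) where
  nodes := positions (sch Γ)
  normal := Γ.biUnion fun σ => σ.frontier.biUnion fun x =>
    σ.body.posVar x ×ˢ posVarSet σ.head x
  special := Γ.biUnion fun σ => σ.frontier.biUnion fun x =>
    σ.body.posVar x ×ˢ σ.exVars.biUnion fun z => posVarSet σ.head z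

end BuildGraph

section SCC

variable {N : Type*} [DecidableEq N]

/-- There is an edge from `u` to `v` in the subgraph of `G` induced by `A`. -/
def DepGraph.EdgeIn (G : DepGraph N) (A : Finset N) (u v : N) : Prop :=
  u ∈ A ∧ v ∈ A ∧ ((u, v) ∈ G.normal ∨ (u, v) ∈ G.special)

instance (G : DepGraph N) (A : Finset N) (u v : N) : Decidable (G.EdgeIn A u v) :=
  inferInstanceAs (Decidable (_ ∧ _ ∧ _))

/-- In the subgraph induced by `A` there is a directed path between every (ordered) pair of
nodes. -/
def DepGraph.StronglyConnected (G : DepGraph N) (A : Finset N) : Prop :=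
  ∀ u ∈ A, ∀ v ∈ A, Relation.ReflTransGen (G.EdgeIn A) u v

/-- `A` is the node set of a strongly connected component of `G`, that is, of a maximal strongly
connected (non-empty, necessarily induced) subgraph. -/
def DepGraph.IsSCC (G : DepGraph N) (A : Finset N) : Prop :=
  A ⊆ G.nodes ∧ A.Nonempty ∧ G.StronglyConnected A ∧
    ∀ B ∈ G.nodes.powerset, A ⊆ B → G.StronglyConnected B → B ⊆ A

/-- The set `A` of nodes contains both ends of some special edge. -/
def DepGraph.HasSpecialEdge (G : DepGraph N) (A : Finset N) : Prop :=
  ∃ e ∈ G.special, e.1 ∈ A ∧ e.2 ∈ A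

/-- Reachability inside a finite set of nodes, in a form that is decidable by finite search. -/
theorem DepGraph.reflTransGen_iff {N : Type*} (G : DepGraph N) (A : Finset N) {u v : N} (hu : u ∈ A) :
    Relation.ReflTransGen (G.EdgeIn A) u v ↔
      ∀ B ∈ A.powerset, u ∈ B → (∀ a ∈ B, ∀ b ∈ A, G.EdgeIn A a b → b ∈ B) → v ∈ B := by
  classical
  constructor
  · intro h B _ huB hcl
    induction h with
    | refl => exact huB
    | tail _ hbc ih => exact hcl _ ih _ hbc.2.1 hbc
  · intro h
    have := h (A.filter (fun w => Relation.ReflTransGen (G.EdgeIn A) u w))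
      (Finset.mem_powerset.mpr (Finset.filter_subset _ _))
      (Finset.mem_filter.mpr ⟨hu, .refl⟩)
      (fun a ha b hb hab => Finset.mem_filter.mpr ⟨hb, (Finset.mem_filter.mp ha).2.tail hab⟩)
    exact (Finset.mem_filter.mp this).2

instance (G : DepGraph N) (A : Finset N) : Decidable (G.StronglyConnected A) :=
  decidable_of_iff (∀ u ∈ A, ∀ v ∈ A, ∀ B ∈ A.powerset, u ∈ B →
      (∀ a ∈ B, ∀ b ∈ A, G.EdgeIn A a b → b ∈ B) → v ∈ B)
    (forall₂_congr fun _ hu => forall₂_congr fun _ _ => (G.reflTransGen_iff A hu).symm)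

instance (G : DepGraph N) (A : Finset N) : Decidable (G.IsSCC A) :=
  inferInstanceAs (Decidable (_ ∧ _ ∧ _ ∧ _))

instance (G : DepGraph N) (A : Finset N) : Decidable (G.HasSpecialEdge A) :=
  inferInstanceAs (Decidable (∃ e ∈ G.special, _))

/-- The set of all special strongly connected components of `G`. -/
def findSpecialSCC (G : DepGraph N) : Finset (Finset N) :=
  G.nodes.powerset.filter (fun A => G.IsSCC A ∧ G.HasSpecialEdge A)

end SCC

/-! ### The termination algorithm -/

/-- The algorithm `IsChaseFinite[L]`. -/
def isChaseFinite {C P V : Type*} [DecidableEq C] [DecidableEq P] [DecidableEq V]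
    (D : Finset (Atom P C)) (Γ : Finset (LinearTGD P V)) : Bool :=
  let Γs := dynSimplification D Γ
  let G := buildDepGraph Γs
  if findSpecialSCC G ≠ ∅ then false else true

end Chase

/-! Simplification commutes with firing a trigger. If `h` maps the body of `σ` to a chase atom and
`f` is the `h`-specialization, a single assignment carries the body and head of `σ.simplify f` to
the simplified body image and the simplified results (`body_simple_map_termAssignment`,
`head_simple_map_termAssignment`). On a head atom this assignment is injective after specialization,
because a fresh null is strictly deeper than the frontier values it is built from. Hence shapes
alone determine which simplified TGDs fire, and dynamic simplification returns exactly those induced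
by triggers on the chase (`mem_dynSimplification`).

So every dependency edge is realized. A term at the source of a normal edge reappears at its target,
and one at the source of a special edge leads to a strictly deeper null there. A cycle through a
special edge therefore yields terms of unbounded depth, and the chase is infinite
(`chase_infinite_of_special_cycle`).

If no special edge lies on a cycle, counting ancestors ranks the positions so that normal edges do
not decrease the rank and special edges increase it. The rank of a position bounds the depth of all
terms occurring there (`exists_rank`, `depth_le_rank`). Only finitely many terms of bounded depth
can be built from `D` and `Γ`, so the chase is finite (`chase_finite_of_depth_lt`). -/

namespace Chase

/-! ### Equality patterns of tuples. -/

section Lists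

variable {T T' : Type*} [DecidableEq T] [DecidableEq T']

theorem mem_unique {t : T} {l : List T} : t ∈ unique l ↔ t ∈ l := by
  induction l with
  | nil => simp [unique]
  | cons a l ih =>
    by_cases h : t = a <;> simp [unique, ih, h]

theorem unique_map {g : T → T'} {l : List T} (hg : Set.InjOn g {t | t ∈ l}) :
    unique (l.map g) = (unique l).map g := by
  induction l with
  | nil => simp [unique]
  | cons a l ih =>
    have hl : Set.InjOn g {t | t ∈ l} := hg.mono fun t ht => List.mem_cons_of_mem a ht
    simp only [List.map_cons, unique, ih hl, List.filter_map]
    congr 2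
    refine List.filter_congr fun t ht => ?_
    have : g t = g a ↔ t = a :=
      hg.eq_iff (List.mem_cons_of_mem _ (mem_unique.1 ht)) List.mem_cons_self
    simp [this]

theorem idxOf_map_of_injOn {g : T → T'} {l : List T} {t : T}
    (hg : ∀ a ∈ l, g a = g t → a = t) : (l.map g).idxOf (g t) = l.idxOf t := by
  induction l with
  | nil => simp
  | cons a l ih =>
    have hl := ih fun b hb => hg b (List.mem_cons_of_mem a hb)
    by_cases h : a = t
    · simp [h]
    · have h' : g a ≠ g t := fun e => h (hg a List.mem_cons_self e)
      rw [List.map_cons, List.idxOf_cons_ne _ h', List.idxOf_cons_ne _ h, hl]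

theorem idTuple_map {g : T → T'} {l : List T} (hg : Set.InjOn g {t | t ∈ l}) :
    idTuple (l.map g) = idTuple l := by
  simp only [idTuple, List.map_map, unique_map hg]
  refine List.map_congr_left fun t ht => ?_
  simp only [Function.comp]
  rw [idxOf_map_of_injOn fun a ha e => hg (mem_unique.1 ha) ht e]

theorem injOn_idxOf_unique (l : List T) :
    Set.InjOn (fun t => (unique l).idxOf t + 1) {t | t ∈ l} := by
  intro a ha b _ hab
  exact (List.idxOf_inj (mem_unique.2 ha)).1 (Nat.succ_injective hab)

theorem idTuple_idTuple (l : List T) : idTuple (idTuple l) = idTuple l :=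
  idTuple_map (injOn_idxOf_unique l)

theorem length_idTuple (l : List T) : (idTuple l).length = l.length := by simp [idTuple]

/-- Numbering the terms of a tuple by first occurrence is injective, so the id-tuple records exactly
which entries coincide. -/
theorem getElem_eq_iff_of_idTuple_eq {l : List T} {l' : List T'} (h : idTuple l = idTuple l')
    {i j : ℕ} (hi : i < l.length) (hj : j < l.length) (hi' : i < l'.length) (hj' : j < l'.length) :
    l[i] = l[j] ↔ l'[i] = l'[j] := by
  have e1 : l[i] = l[j] ↔
      (idTuple l)[i]'(by simpa [idTuple]) = (idTuple l)[j]'(by simpa [idTuple]) := by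
    simp only [idTuple, List.getElem_map]
    exact ((injOn_idxOf_unique l).eq_iff (List.getElem_mem hi) (List.getElem_mem hj)).symm
  have e2 : l'[i] = l'[j] ↔
      (idTuple l')[i]'(by simpa [idTuple]) = (idTuple l')[j]'(by simpa [idTuple]) := by
    simp only [idTuple, List.getElem_map]
    exact ((injOn_idxOf_unique l').eq_iff (List.getElem_mem hi') (List.getElem_mem hj')).symm
  rw [e1, e2]
  simp only [h]

end Lists

/-! ### Shapes under renaming, and transfer of homomorphisms between atoms of equal shape. -/

section Atoms

variable {P V T T' : Type*} [DecidableEq T] [DecidableEq T']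

theorem Atom.simple_map {g : T → T'} {α : Atom P T} (hg : Set.InjOn g {t | t ∈ α.args}) :
    (α.map g).simple = α.simple.map g := by
  simp [Atom.simple, Atom.map, Atom.shape, unique_map hg, idTuple_map hg]

theorem Atom.shape_map {g : T → T'} {α : Atom P T} (hg : Set.InjOn g {t | t ∈ α.args}) :
    (α.map g).shape = α.shape :=
  congrArg Atom.pred (Atom.simple_map hg)

theorem Atom.shape_toAtom_shape (α : Atom P T) : α.shape.toAtom.shape = α.shape := by
  simp [Atom.shape, Shape.toAtom, idTuple_idTuple]

variable [DecidableEq V]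

theorem apply_hSpecialization (x : List V) (h : V → T) (v : V) :
    h (hSpecialization x h v) = h v := by
  unfold hSpecialization
  split_ifs with hv
  · obtain ⟨r, hr⟩ : ∃ r, x.find? (fun w => h w = h v) = some r :=
      Option.isSome_iff_exists.mp (List.find?_isSome.mpr ⟨v, hv, decide_eq_true rfl⟩)
    have := List.find?_some hr
    simpa [hr] using this
  · rfl

theorem hSpecialization_mem {x : List V} (h : V → T) {v : V} (hv : v ∈ x) :
    hSpecialization x h v ∈ x := by
  obtain ⟨r, hr⟩ : ∃ r, x.find? (fun w => h w = h v) = some r :=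
    Option.isSome_iff_exists.mp (List.find?_isSome.mpr ⟨v, hv, decide_eq_true rfl⟩)
  simpa [hSpecialization, hv, hr] using List.mem_of_find?_eq_some hr

theorem hSpecialization_of_notMem {x : List V} (h : V → T) {v : V} (hv : v ∉ x) :
    hSpecialization x h v = v := by
  simp [hSpecialization, hv]

/-- A homomorphism from `α` to an atom transfers to every atom of the same shape, with the same
identifications of variables. -/
theorem exists_map_eq_of_shape_eq {α : Atom P V} {h : V → T} {β : Atom P T'}
    (hne : V → Nonempty T') (hs : (α.map h).shape = β.shape) :
    ∃ h' : V → T', α.map h' = β ∧ hSpecialization α.args h' = hSpecialization α.args h := by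
  have hp : α.pred = β.pred := congrArg Shape.pred hs
  have hid : idTuple (α.args.map h) = idTuple β.args := congrArg Shape.id hs
  have hlen : α.args.length = β.args.length := by
    simpa [length_idTuple] using congrArg List.length hid
  let h' : V → T' := fun v =>
    if hv : v ∈ α.args then β.args[α.args.idxOf v]'(hlen ▸ List.idxOf_lt_length_of_mem hv)
    else (hne v).some
  have hval : ∀ i (hi : i < α.args.length), h' α.args[i] = β.args[i]'(hlen ▸ hi) := by
    intro i hi
    have hm : α.args[i] ∈ α.args := List.getElem_mem hi
    have hj := List.idxOf_lt_length_of_mem hm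
    simp only [h', hm, dif_pos]
    -- `h'` reads its value at the first occurrence of the variable; equality of shapes forces the
    -- same value of `β` at all its other occurrences.
    refine (getElem_eq_iff_of_idTuple_eq hid (by simpa using hj) (by simpa using hi) _ _).1 ?_
    simp
  refine ⟨h', Atom.ext hp (List.ext_getElem (by simpa [Atom.map] using hlen) ?_), ?_⟩
  · intro i h1 h2
    simpa [Atom.map] using hval i (hlen ▸ h2)
  · refine (isSpecialization_hSpecialization _ _).unique
      (isSpecialization_hSpecialization _ _) fun v hv w hw => ?_
    rw [hSpecialization_eq_iff _ hv hw, hSpecialization_eq_iff _ hv hw]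
    obtain ⟨i, hi, rfl⟩ := List.getElem_of_mem hv
    obtain ⟨j, hj, rfl⟩ := List.getElem_of_mem hw
    rw [hval i hi, hval j hj]
    have e := getElem_eq_iff_of_idTuple_eq hid (by simpa using hi) (by simpa using hj)
      (hlen ▸ hi) (hlen ▸ hj)
    rw [List.getElem_map, List.getElem_map] at e
    exact e.symm

/-- Replacing each argument by the index of its first occurrence keeps the equality pattern and
gives a tuple over `Fin` of the arity. -/
theorem Atom.shape_mem_shapesOfSchema [DecidableEq P] {Sch : Finset (P × ℕ)} {α : Atom P T}
    (hα : (α.pred, α.args.length) ∈ Sch) : α.shape ∈ shapesOfSchema Sch := by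
  refine Finset.mem_biUnion.2 ⟨_, hα, Finset.mem_image.2 ?_⟩
  let t : Fin α.args.length → Fin α.args.length := fun i =>
    ⟨α.args.idxOf α.args[i], List.idxOf_lt_length_of_mem (List.getElem_mem _)⟩
  refine ⟨t, Finset.mem_univ _, ?_⟩
  have hmap : α.args = (List.ofFn t).map fun k => α.args[k] := by
    refine List.ext_getElem (by simp) fun i h1 h2 => ?_
    simp [t]
  have hinj : Set.InjOn (fun k : Fin α.args.length => α.args[k]) {k | k ∈ List.ofFn t} := by
    rintro a ha b hb hab
    obtain ⟨i, rfl⟩ := List.mem_ofFn.1 ha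
    obtain ⟨j, rfl⟩ := List.mem_ofFn.1 hb
    have hab' : α.args[i] = α.args[j] := by simpa [t] using hab
    simp only [Fin.getElem_fin] at hab'
    simp [t, hab']
  have := idTuple_map hinj
  rw [← hmap] at this
  exact Shape.ext rfl this.symm

end Atoms

/-! ### Depth of nulls, and simplification of triggers. -/

section GTerm

variable {C P V : Type*} [DecidableEq V]

/-- The nesting depth of nulls; a null with empty frontier has depth `0`. -/
def GTerm.depth : GTerm C P V → ℕ
  | .const _ => 0
  | .null _ h _ => Finset.univ.sup fun v => (h v).depth + 1

theorem GTerm.depth_lt_depth_null {σ : LinearTGD P V}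
    (h : {v : V // v ∈ σ.frontier} → GTerm C P V) (x : V) (v : {v : V // v ∈ σ.frontier}) :
    (h v).depth < (GTerm.null σ h x).depth := by
  rw [GTerm.depth]
  exact Finset.le_sup (f := fun v => (h v).depth + 1) (Finset.mem_univ v)

/-- There may be no constants, so the witness is a null of a TGD without variables, which needs no
arguments. It supplies default values outside a body. -/
theorem GTerm.nonempty (p : P) (v : V) : Nonempty (GTerm C P V) := by
  let σ : LinearTGD P V := ⟨⟨p, []⟩, {⟨p, []⟩}, Finset.singleton_nonempty _⟩
  have hσ : ∀ w, w ∉ σ.frontier := by simp [σ, LinearTGD.frontier, Atom.vars]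
  exact ⟨.null σ (fun w => (hσ w.1 w.2).elim) v⟩

theorem mem_headVars {σ : LinearTGD P V} {v : V} :
    v ∈ σ.headVars ↔ ∃ α ∈ σ.head, v ∈ α.args := by
  simp [LinearTGD.headVars, Atom.vars]

theorem mem_frontier {σ : LinearTGD P V} {v : V} :
    v ∈ σ.frontier ↔ v ∈ σ.body.args ∧ ∃ α ∈ σ.head, v ∈ α.args := by
  simp [LinearTGD.frontier, Atom.vars, mem_headVars]

theorem mem_exVars {σ : LinearTGD P V} {v : V} :
    v ∈ σ.exVars ↔ (∃ α ∈ σ.head, v ∈ α.args) ∧ v ∉ σ.body.args := by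
  simp [LinearTGD.exVars, Atom.vars, mem_headVars]

/-- The common extension of `h` and of the choice of nulls to all variables of `σ`. -/
def termAssignment (σ : LinearTGD P V) (h : V → GTerm C P V) (v : V) : GTerm C P V :=
  if v ∈ σ.body.args then h v else GTerm.null σ (fun v => h v.1) v

variable [DecidableEq (GTerm C P V)]

theorem termAssignment_hSpecialization_of_mem (σ : LinearTGD P V) (h : V → GTerm C P V) {v : V}
    (hv : v ∈ σ.body.args) :
    termAssignment σ h (hSpecialization σ.body.args h v) = h v := by
  rw [termAssignment, if_pos (hSpecialization_mem h hv), apply_hSpecialization σ.body.args h]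

theorem termAssignment_hSpecialization_of_notMem (σ : LinearTGD P V) (h : V → GTerm C P V) {v : V}
    (hv : v ∉ σ.body.args) :
    termAssignment σ h (hSpecialization σ.body.args h v) = GTerm.null σ (fun v => h v.1) v := by
  rw [hSpecialization_of_notMem h hv, termAssignment, if_neg hv]

/-- The two assignments can differ only on body variables outside the frontier, and these do not
occur in the head. -/
theorem termAssignment_hSpecialization_of_mem_headVars {σ : LinearTGD P V} (h : V → GTerm C P V)
    {α : Atom P V} (hα : α ∈ σ.head) {v : V} (hv : v ∈ α.args) :
    termAssignment σ h (hSpecialization σ.body.args h v) = headAssignment σ h v := by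
  by_cases hb : v ∈ σ.body.args
  · rw [termAssignment_hSpecialization_of_mem σ h hb, headAssignment,
      if_pos (mem_frontier.2 ⟨hb, α, hα, hv⟩)]
  · rw [termAssignment_hSpecialization_of_notMem σ h hb, headAssignment,
      if_neg fun hf => hb (mem_frontier.1 hf).1]

theorem head_simple_map_termAssignment {σ : LinearTGD P V} (h : V → GTerm C P V)
    {α : Atom P V} (hα : α ∈ σ.head) :
    (α.map (headAssignment σ h)).simple =
      (α.map (hSpecialization σ.body.args h)).simple.map (termAssignment σ h) := by
  have hm : α.map (headAssignment σ h) =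
      (α.map (hSpecialization σ.body.args h)).map (termAssignment σ h) := by
    refine Atom.ext rfl ?_
    simp only [Atom.map, List.map_map]
    exact List.map_congr_left fun v hv =>
      (termAssignment_hSpecialization_of_mem_headVars h hα hv).symm
  -- A frontier value is an argument of each null created by the trigger, hence strictly less deep
  -- than it.
  have hlt : ∀ v ∈ α.args, v ∈ σ.body.args → ∀ w,
      h v ≠ GTerm.null σ (fun v => h v.1) w := fun v hv hb w e =>
    (GTerm.depth_lt_depth_null (fun v => h v.1) w
      ⟨v, mem_frontier.2 ⟨hb, α, hα, hv⟩⟩).ne (congrArg GTerm.depth e)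
  rw [hm, Atom.simple_map]
  rintro a ha b hb hab
  obtain ⟨v, hv, rfl⟩ := List.mem_map.1 ha
  obtain ⟨w, hw, rfl⟩ := List.mem_map.1 hb
  by_cases hvb : v ∈ σ.body.args <;> by_cases hwb : w ∈ σ.body.args
  · rwa [termAssignment_hSpecialization_of_mem σ h hvb,
      termAssignment_hSpecialization_of_mem σ h hwb, ← hSpecialization_eq_iff h hvb hwb] at hab
  · rw [termAssignment_hSpecialization_of_mem σ h hvb,
      termAssignment_hSpecialization_of_notMem σ h hwb] at hab
    exact (hlt v hv hvb w hab).elim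
  · rw [termAssignment_hSpecialization_of_notMem σ h hvb,
      termAssignment_hSpecialization_of_mem σ h hwb] at hab
    exact (hlt w hw hwb v hab.symm).elim
  -- Nulls of one trigger are distinguished by their variable.
  · rw [termAssignment_hSpecialization_of_notMem σ h hvb,
      termAssignment_hSpecialization_of_notMem σ h hwb, GTerm.null.injEq] at hab
    rw [hab.2.2]

variable [DecidableEq P]

theorem body_simple_map_termAssignment (σ : LinearTGD P V) (h : V → GTerm C P V) :
    (σ.body.map h).simple =
      (σ.simplify (hSpecialization σ.body.args h)).body.map (termAssignment σ h) := by
  have hm : σ.body.map h =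
      (σ.body.map (hSpecialization σ.body.args h)).map (termAssignment σ h) := by
    refine Atom.ext rfl ?_
    simp only [Atom.map, List.map_map]
    exact List.map_congr_left fun v hv => (termAssignment_hSpecialization_of_mem σ h hv).symm
  rw [hm, Atom.simple_map]
  · rfl
  · rintro a ha b hb hab
    obtain ⟨v, hv, rfl⟩ := List.mem_map.1 ha
    obtain ⟨w, hw, rfl⟩ := List.mem_map.1 hb
    rwa [termAssignment_hSpecialization_of_mem σ h hv,
      termAssignment_hSpecialization_of_mem σ h hw, ← hSpecialization_eq_iff h hv hw] at hab

end GTerm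

/-! ### Variables of a simplified TGD. -/

section Simplify

variable {P V : Type*} [DecidableEq P] [DecidableEq V] {σ : LinearTGD P V}

theorem mem_simplify_body {f : V → V} {x : V} :
    x ∈ (σ.simplify f).body.args ↔ ∃ v ∈ σ.body.args, f v = x := by
  simp [LinearTGD.simplify, Atom.simple, mem_unique, Atom.map]

theorem exists_mem_simplify_head {f : V → V} {x : V} :
    (∃ α ∈ (σ.simplify f).head, x ∈ α.args) ↔ ∃ α ∈ σ.head, ∃ v ∈ α.args, f v = x := by
  simp [LinearTGD.simplify, Atom.simple, mem_unique, Atom.map]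

end Simplify

/-! ### The fixed point reached by the loop. -/

section Loop

variable {P V : Type*} [DecidableEq P] [DecidableEq V] {Γ : Finset (LinearTGD P V)}

theorem applicable_empty : applicable ∅ Γ = ∅ := by
  ext τ
  simp [mem_applicable, inducedDB]

theorem applicable_union (S S' : Finset (Shape P)) :
    applicable (S ∪ S') Γ = applicable S Γ ∪ applicable S' Γ := by
  ext τ
  simp only [Finset.mem_union, mem_applicable, inducedDB, Finset.image_union]
  constructor
  · rintro ⟨σ, hσ, h, hh | hh, e⟩
    · exact Or.inl ⟨σ, hσ, h, hh, e⟩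
    · exact Or.inr ⟨σ, hσ, h, hh, e⟩
  · rintro (⟨σ, hσ, h, hh, e⟩ | ⟨σ, hσ, h, hh, e⟩)
    · exact ⟨σ, hσ, h, Or.inl hh, e⟩
    · exact ⟨σ, hσ, h, Or.inr hh, e⟩

theorem headShapes_union (A B : Finset (LinearTGD (Shape P) V)) :
    headShapes Γ (A ∪ B) = headShapes Γ A ∪ headShapes Γ B := by
  ext s
  simp only [headShapes, Finset.mem_union, Finset.mem_filter, or_and_right, exists_or, and_or_left]

/-- The loop computes the simplifications applicable to a set of shapes which is closed under
passing to head shapes, and which contains only shapes that every such closed set contains. -/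
theorem dynLoop_spec (p : Shape P → Prop)
    (hp : ∀ S : Finset (Shape P), (∀ s ∈ S, p s) → ∀ s ∈ headShapes Γ (applicable S Γ), p s)
    (S ΔS : Finset (Shape P)) (Γs : Finset (LinearTGD (Shape P) V)) (hS : ∀ s ∈ S, p s)
    (hΔ : ΔS ⊆ S) (happ : applicable S Γ = Γs ∪ applicable ΔS Γ) (hhead : headShapes Γ Γs ⊆ S) :
    ∃ S', S ⊆ S' ∧ (∀ s ∈ S', p s) ∧ dynLoop Γ S ΔS Γs = applicable S' Γ ∧
      headShapes Γ (applicable S' Γ) ⊆ S' := by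
  -- Invariant: what is collected, plus what `ΔS` still contributes, is all that applies to `S`, and
  -- the head shapes of the collected part lie in `S`. When `ΔS` is empty this makes `S` closed.
  induction S, ΔS, Γs using dynLoop.induct (Γ := Γ) with
  | case1 S Γs =>
    have h0 : applicable S Γ = Γs := by simpa [applicable_empty] using happ
    refine ⟨S, Finset.Subset.refl _, hS, ?_, h0 ▸ hhead⟩
    rw [dynLoop, if_pos rfl, h0]
  | case2 S ΔS Γs hne Γaux ΔS' ih =>
    obtain ⟨S', h1, h2, h3, h4⟩ := ih
      (fun s hs => (Finset.mem_union.1 hs).elim (hS s) fun hs' =>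
        hp ΔS (fun t ht => hS t (hΔ ht)) s (Finset.mem_sdiff.1 hs').1)
      Finset.subset_union_right
      (by rw [applicable_union, happ])
      (by
        rw [headShapes_union]
        refine Finset.union_subset (hhead.trans Finset.subset_union_left) fun s hs => ?_
        by_cases h : s ∈ S
        · exact Finset.mem_union_left _ h
        · exact Finset.mem_union_right _ (Finset.mem_sdiff.2 ⟨hs, h⟩))
    refine ⟨S', Finset.subset_union_left.trans h1, h2, ?_, h4⟩
    rw [dynLoop, if_neg hne]
    exact h3

end Loop

/-! ### Collected simplifications are those of triggers on the chase. -/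

section Dynamic

variable {C P V : Type*} [DecidableEq V] {D : Finset (Atom P C)} {Γ : Finset (LinearTGD P V)}

theorem map_headAssignment_mem_chase {σ : LinearTGD P V} {h : V → GTerm C P V} {α : Atom P V}
    (ht : IsTrigger (Γ : Set (LinearTGD P V)) (chase D Γ) σ h) (hα : α ∈ σ.head) :
    α.map (headAssignment σ h) ∈ chase D Γ := by
  obtain ⟨i, hi⟩ := Set.mem_iUnion.1 ht.2
  exact Set.mem_iUnion.2 ⟨i + 1, Or.inr ⟨σ, h, ⟨ht.1, hi⟩, α, hα, rfl⟩⟩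

/-- Induction over the chase. -/
theorem chase_induction {p : Atom P (GTerm C P V) → Prop}
    (h0 : ∀ α ∈ D, p (α.map GTerm.const))
    (h1 : ∀ σ h, IsTrigger (Γ : Set (LinearTGD P V)) (chase D Γ) σ h → p (σ.body.map h) →
      ∀ α ∈ σ.head, p (α.map (headAssignment σ h)))
    {β : Atom P (GTerm C P V)} (hβ : β ∈ chase D Γ) : p β := by
  obtain ⟨i, hi⟩ := Set.mem_iUnion.1 hβ
  induction i generalizing β with
  | zero =>
    obtain ⟨α, hα, rfl⟩ := hi
    exact h0 α hα
  | succ i ih =>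
    rcases hi with hi | ⟨σ, h, ht, α, hα, rfl⟩
    · exact ih hβ hi
    · have hb : σ.body.map h ∈ chase D Γ := Set.mem_iUnion.2 ⟨i, ht.2⟩
      exact h1 σ h ⟨ht.1, hb⟩ (ih hb ht.2) α hα

variable [DecidableEq P] [DecidableEq (GTerm C P V)]

/-- The atom of `DB[S]` encoding a shape has that shape itself, so a homomorphism into the chase can
be exchanged for one into `DB[S]` without changing the specialization. -/
theorem simplify_mem_applicable {S : Finset (Shape P)} {σ : LinearTGD P V} (hσ : σ ∈ Γ)
    {h : V → GTerm C P V} (hS : (σ.body.map h).shape ∈ S) :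
    σ.simplify (hSpecialization σ.body.args h) ∈ applicable S Γ := by
  obtain ⟨h', hm, hs⟩ := exists_map_eq_of_shape_eq (fun _ => ⟨0⟩)
    (Atom.shape_toAtom_shape (σ.body.map h)).symm
  exact mem_applicable.2 ⟨σ, hσ, h', Finset.mem_image.2 ⟨_, hS, hm.symm⟩, by rw [hs]⟩

/-- The reverse exchange; it needs every shape of `S` to be realized by a chase atom. -/
theorem exists_trigger_of_mem_applicable {S : Finset (Shape P)}
    (hS : ∀ s ∈ S, ∃ β ∈ chase D Γ, β.shape = s) {τ : LinearTGD (Shape P) V}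
    (hτ : τ ∈ applicable S Γ) :
    ∃ σ h, IsTrigger (Γ : Set (LinearTGD P V)) (chase D Γ) σ h ∧
      τ = σ.simplify (hSpecialization σ.body.args h) := by
  obtain ⟨σ, hσ, h', hm, rfl⟩ := mem_applicable.1 hτ
  obtain ⟨s, hs, hsm⟩ := Finset.mem_image.1 hm
  obtain ⟨β, hβ, rfl⟩ := hS s hs
  obtain ⟨h, hh, he⟩ := exists_map_eq_of_shape_eq (GTerm.nonempty σ.body.pred)
    ((congrArg Atom.shape hsm).symm.trans (Atom.shape_toAtom_shape β))
  exact ⟨σ, h, ⟨hσ, hh ▸ hβ⟩, by rw [he]⟩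

omit [DecidableEq P] in
theorem shape_head_simplify {σ : LinearTGD P V} (h : V → GTerm C P V) {α : Atom P V}
    (hα : α ∈ σ.head) :
    (α.map (headAssignment σ h)).shape = (α.map (hSpecialization σ.body.args h)).shape :=
  congrArg Atom.pred (head_simple_map_termAssignment h hα)

/-- Dynamic simplification collects the simplifications induced by the triggers on the chase. -/
theorem mem_dynSimplification [DecidableEq C] {τ : LinearTGD (Shape P) V} :
    τ ∈ dynSimplification D Γ ↔
      ∃ σ, ∃ h : V → GTerm C P V, IsTrigger (Γ : Set (LinearTGD P V)) (chase D Γ) σ h ∧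
        τ = σ.simplify (hSpecialization σ.body.args h) := by
  have hconst : ∀ α : Atom P C, (α.map (GTerm.const : C → GTerm C P V)).shape = α.shape :=
    fun α => Atom.shape_map fun a _ b _ hab => by simpa using hab
  obtain ⟨S, hD, hreal, hdyn, hclosed⟩ := dynLoop_spec (Γ := Γ)
    (fun s => ∃ β ∈ chase (V := V) D Γ, β.shape = s)
    (by
      intro S hS s hs
      obtain ⟨-, τ, hτ, α', hα', rfl⟩ := Finset.mem_filter.1 hs
      obtain ⟨σ, h, ht, rfl⟩ := exists_trigger_of_mem_applicable hS hτ
      obtain ⟨α, hα, rfl⟩ := Finset.mem_image.1 hα'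
      exact ⟨_, map_headAssignment_mem_chase ht hα, shape_head_simplify h hα⟩)
    (findShapes D) (findShapes D) ∅
    (by
      intro s hs
      obtain ⟨α, hα, rfl⟩ := Finset.mem_image.1 hs
      exact ⟨_, Set.mem_iUnion.2 ⟨0, α, hα, rfl⟩, hconst α⟩)
    (Finset.Subset.refl _) (by simp) (by simp [headShapes])
  rw [dynSimplification, hdyn]
  have hall : ∀ β ∈ chase (V := V) D Γ, β.shape ∈ S := by
    intro β hβ
    refine chase_induction (p := fun β => β.shape ∈ S) ?_ ?_ hβ
    · intro α hα
      rw [hconst]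
      exact hD (Finset.mem_image_of_mem _ hα)
    · intro σ h ht hb α hα
      rw [shape_head_simplify h hα]
      -- Restricting head shapes to the schema loses nothing, since the predicate and arity come
      -- from a head atom of `Γ`.
      refine hclosed (Finset.mem_filter.2 ⟨Atom.shape_mem_shapesOfSchema ?_,
        _, simplify_mem_applicable ht.1 hb, _, Finset.mem_image_of_mem _ hα, rfl⟩)
      refine Finset.mem_image.2 ⟨α, Finset.mem_biUnion.2 ⟨σ, ht.1, Finset.mem_insert_of_mem hα⟩, ?_⟩
      simp [Atom.map]
  constructor
  · exact exists_trigger_of_mem_applicable hreal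
  · rintro ⟨σ, h, ht, rfl⟩
    exact simplify_mem_applicable ht.1 (hall _ ht.2)

end Dynamic
-- Special components, cycles and ranks.
section SCC

variable {N : Type*} {G : DepGraph N}

theorem DepGraph.EdgeIn.mono {A B : Finset N} (hAB : A ⊆ B) {u v : N} (h : G.EdgeIn A u v) :
    G.EdgeIn B u v :=
  ⟨hAB h.1, hAB h.2.1, h.2.2⟩

/-- There is a special component if and only if some special edge lies on a cycle. -/
theorem findSpecialSCC_eq_empty_iff [DecidableEq N]
    (hG : ∀ e ∈ G.special, e.1 ∈ G.nodes ∧ e.2 ∈ G.nodes) :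
    findSpecialSCC G = ∅ ↔
      ∀ e ∈ G.special, ¬ Relation.ReflTransGen (G.EdgeIn G.nodes) e.2 e.1 := by
  classical
  constructor
  · rintro h0 ⟨u, v⟩ he hvu
    have huv : Relation.ReflTransGen (G.EdgeIn G.nodes) u v :=
      .single ⟨(hG _ he).1, (hG _ he).2, Or.inr he⟩
    let A := G.nodes.filter fun w => Relation.ReflTransGen (G.EdgeIn G.nodes) u w ∧
      Relation.ReflTransGen (G.EdgeIn G.nodes) w u
    have hmem : ∀ w, w ∈ A ↔ w ∈ G.nodes ∧ Relation.ReflTransGen (G.EdgeIn G.nodes) u w ∧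
      Relation.ReflTransGen (G.EdgeIn G.nodes) w u := fun w => Finset.mem_filter
    have hu : u ∈ A := (hmem u).2 ⟨(hG _ he).1, .refl, .refl⟩
    have hv : v ∈ A := (hmem v).2 ⟨(hG _ he).2, huv, hvu⟩
    -- A path between members of `A` never leaves `A`: each of its nodes lies on a closed walk
    -- through `u`.
    have hpath : ∀ a b, b ∈ A → Relation.ReflTransGen (G.EdgeIn G.nodes) a b → a ∈ A →
        Relation.ReflTransGen (G.EdgeIn A) a b := by
      intro a b hb hab
      induction hab using Relation.ReflTransGen.head_induction_on with
      | refl => exact fun _ => .refl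
      | head h1 h2 ih =>
        intro ha
        have hc := (hmem _).2 ⟨h1.2.1, ((hmem _).1 ha).2.1.tail h1, h2.trans ((hmem _).1 hb).2.2⟩
        exact .head ⟨ha, hc, h1.2.2⟩ (ih hc)
    have hA : A ∈ findSpecialSCC G := by
      refine Finset.mem_filter.2 ⟨Finset.mem_powerset.2 (Finset.filter_subset _ _),
        ⟨Finset.filter_subset _ _, ⟨u, hu⟩, ?_, ?_⟩, (u, v), he, hu, hv⟩
      · intro a ha b hb
        exact hpath a b hb (((hmem a).1 ha).2.2.trans ((hmem b).1 hb).2.1) ha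
      · intro B hB hAB hBc b hb
        have hB' := Finset.mem_powerset.1 hB
        exact (hmem b).2 ⟨hB' hb,
          Relation.ReflTransGen.mono (fun _ _ h => h.mono hB') _ _
            (hBc u (hAB hu) b hb),
          Relation.ReflTransGen.mono (fun _ _ h => h.mono hB') _ _
            (hBc b hb u (hAB hu))⟩
    simp [h0] at hA
  · intro h
    refine Finset.eq_empty_of_forall_notMem fun A hA => ?_
    obtain ⟨-, ⟨hsub, -, hc, -⟩, e, he, h1, h2⟩ := Finset.mem_filter.1 hA
    exact h e he (Relation.ReflTransGen.mono (fun _ _ h => h.mono hsub) _ _ (hc _ h2 _ h1))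

/-- Without special edges on cycles, the nodes can be ranked. -/
theorem exists_rank (hG : ∀ e ∈ G.special, e.1 ∈ G.nodes ∧ e.2 ∈ G.nodes)
    (hG' : ∀ e ∈ G.normal, e.1 ∈ G.nodes ∧ e.2 ∈ G.nodes)
    (h : ∀ e ∈ G.special, ¬ Relation.ReflTransGen (G.EdgeIn G.nodes) e.2 e.1) :
    ∃ r : N → ℕ, (∀ u v, (u, v) ∈ G.normal → r u ≤ r v) ∧
      (∀ u v, (u, v) ∈ G.special → r u < r v) ∧ ∀ u, r u ≤ G.nodes.card := by
  classical
  -- The rank counts ancestors, the node itself included. Edges only enlarge the ancestor set; a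
  -- special edge adds its target, which is not an ancestor of its source.
  let anc : N → Finset N := fun v =>
    G.nodes.filter fun w => Relation.ReflTransGen (G.EdgeIn G.nodes) w v
  have hanc : ∀ {u v}, G.EdgeIn G.nodes u v → anc u ⊆ anc v := fun huv w hw =>
    Finset.mem_filter.2 ⟨(Finset.mem_filter.1 hw).1, (Finset.mem_filter.1 hw).2.tail huv⟩
  refine ⟨fun v => (anc v).card, fun u v huv => Finset.card_le_card
    (hanc ⟨(hG' _ huv).1, (hG' _ huv).2, Or.inl huv⟩), fun u v huv => Finset.card_lt_card
    ((Finset.ssubset_iff_of_subset (hanc ⟨(hG _ huv).1, (hG _ huv).2, Or.inr huv⟩)).2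
      ⟨v, Finset.mem_filter.2 ⟨(hG _ huv).2, .refl⟩,
        fun hv => h _ huv (Finset.mem_filter.1 hv).2⟩),
    fun u => Finset.card_le_card (Finset.filter_subset _ _)⟩

end SCC

/-! ### Edges of the dependency graph. -/

section BuildGraph

variable {P V : Type*} [DecidableEq P] [DecidableEq V] {Γ : Finset (LinearTGD P V)}

theorem mem_posVar {α : Atom P V} {x : V} {u : P × ℕ} :
    u ∈ α.posVar x ↔ α.pred = u.1 ∧ α.args[u.2]? = some x := by
  obtain ⟨p, i⟩ := u
  simp only [Atom.posVar, Finset.mem_image, Finset.mem_filter, Finset.mem_range, Prod.mk.injEq]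
  constructor
  · rintro ⟨j, ⟨-, hj⟩, rfl, rfl⟩
    exact ⟨rfl, hj⟩
  · rintro ⟨rfl, hi⟩
    exact ⟨i, ⟨(List.getElem?_eq_some_iff.1 hi).1, hi⟩, rfl, rfl⟩

theorem exists_mem_posVar {α : Atom P V} {x : V} (hx : x ∈ α.args) : ∃ u, u ∈ α.posVar x := by
  obtain ⟨i, hi⟩ := List.mem_iff_getElem?.1 hx
  exact ⟨(α.pred, i), mem_posVar.2 ⟨rfl, hi⟩⟩

theorem mem_normal_buildDepGraph {u v : P × ℕ} :
    (u, v) ∈ (buildDepGraph Γ).normal ↔ ∃ τ ∈ Γ, ∃ x ∈ τ.frontier, u ∈ τ.body.posVar x ∧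
      ∃ α ∈ τ.head, v ∈ α.posVar x := by
  simp [buildDepGraph, posVarSet]

theorem mem_special_buildDepGraph {u v : P × ℕ} :
    (u, v) ∈ (buildDepGraph Γ).special ↔ ∃ τ ∈ Γ, ∃ x ∈ τ.frontier, u ∈ τ.body.posVar x ∧
      ∃ z ∈ τ.exVars, ∃ α ∈ τ.head, v ∈ α.posVar z := by
  simp [buildDepGraph, posVarSet]

theorem mem_positions_of_mem_posVar {α : Atom P V} (hα : α ∈ atomsOf Γ) {x : V} {u : P × ℕ}
    (hu : u ∈ α.posVar x) : u ∈ (buildDepGraph Γ).nodes := by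
  obtain ⟨h1, h2⟩ := mem_posVar.1 hu
  refine Finset.mem_biUnion.2 ⟨_, Finset.mem_image_of_mem _ hα, Finset.mem_image.2
    ⟨u.2, Finset.mem_range.2 (List.getElem?_eq_some_iff.1 h2).1, Prod.ext h1 rfl⟩⟩

theorem body_mem_atomsOf {τ : LinearTGD P V} (hτ : τ ∈ Γ) : τ.body ∈ atomsOf Γ :=
  Finset.mem_biUnion.2 ⟨τ, hτ, Finset.mem_insert_self _ _⟩

theorem head_mem_atomsOf {τ : LinearTGD P V} (hτ : τ ∈ Γ) {α : Atom P V} (hα : α ∈ τ.head) :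
    α ∈ atomsOf Γ :=
  Finset.mem_biUnion.2 ⟨τ, hτ, Finset.mem_insert_of_mem hα⟩

theorem normal_subset_nodes : ∀ e ∈ (buildDepGraph Γ).normal,
    e.1 ∈ (buildDepGraph Γ).nodes ∧ e.2 ∈ (buildDepGraph Γ).nodes := by
  rintro ⟨u, v⟩ he
  obtain ⟨τ, hτ, x, -, hu, α, hα, hv⟩ := mem_normal_buildDepGraph.1 he
  exact ⟨mem_positions_of_mem_posVar (body_mem_atomsOf hτ) hu,
    mem_positions_of_mem_posVar (head_mem_atomsOf hτ hα) hv⟩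

theorem special_subset_nodes : ∀ e ∈ (buildDepGraph Γ).special,
    e.1 ∈ (buildDepGraph Γ).nodes ∧ e.2 ∈ (buildDepGraph Γ).nodes := by
  rintro ⟨u, v⟩ he
  obtain ⟨τ, hτ, x, -, hu, z, -, α, hα, hv⟩ := mem_special_buildDepGraph.1 he
  exact ⟨mem_positions_of_mem_posVar (body_mem_atomsOf hτ) hu,
    mem_positions_of_mem_posVar (head_mem_atomsOf hτ hα) hv⟩

end BuildGraph
-- The chase is finite exactly when its terms have bounded depth.
theorem finite_lists_of_length {T : Type*} {A : Set T} (hA : A.Finite) (n : ℕ) :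
    {l : List T | l.length = n ∧ ∀ t ∈ l, t ∈ A}.Finite := by
  have := hA.to_subtype
  refine ((List.finite_length_eq A n).image (List.map Subtype.val)).subset ?_
  rintro l ⟨hl, hm⟩
  lift l to List A using hm
  exact ⟨l, by simpa using hl, rfl⟩

section Terms

variable {C P V : Type*} [DecidableEq V]

/-- The terms built from the constants of `D` and the TGDs of `Γ`. -/
inductive IsTermOver (D : Finset (Atom P C)) (Γ : Finset (LinearTGD P V)) : GTerm C P V → Prop
  | const {α : Atom P C} {c : C} : α ∈ D → c ∈ α.args → IsTermOver D Γ (.const c)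
  | null {σ : LinearTGD P V} {h : {v : V // v ∈ σ.frontier} → GTerm C P V} {x : V} :
      σ ∈ Γ → x ∈ σ.headVars → (∀ v, IsTermOver D Γ (h v)) → IsTermOver D Γ (.null σ h x)

variable {D : Finset (Atom P C)} {Γ : Finset (LinearTGD P V)}

/-- A null is given by a TGD, a head variable and a map from the frontier to terms of smaller depth,
so each level has finitely many choices. -/
theorem finite_terms_of_depth_lt (n : ℕ) :
    {t | IsTermOver D Γ t ∧ t.depth < n}.Finite := by
  induction n with
  | zero => simp
  | succ n ih =>
    have h1 : (⋃ α ∈ D, (GTerm.const : C → GTerm C P V) '' {c | c ∈ α.args}).Finite :=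
      D.finite_toSet.biUnion fun α _ => α.args.finite_toSet.image _
    have h2 : (⋃ σ ∈ Γ, ⋃ x ∈ σ.headVars, (fun h => GTerm.null σ h x) ''
        {h : {v : V // v ∈ σ.frontier} → GTerm C P V |
          ∀ v, h v ∈ {t | IsTermOver D Γ t ∧ t.depth < n}}).Finite :=
      Γ.finite_toSet.biUnion fun σ _ => σ.headVars.finite_toSet.biUnion fun x _ =>
        (Set.Finite.pi' fun _ => ih).image _
    refine (h1.union h2).subset ?_
    rintro t ⟨ht, hd⟩
    cases ht with
    | const hα hc => exact Or.inl (Set.mem_biUnion hα ⟨_, hc, rfl⟩)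
    | @null σ h x hσ hx hh =>
      exact Or.inr (Set.mem_biUnion hσ (Set.mem_biUnion hx ⟨h, fun v => ⟨hh v,
        (GTerm.depth_lt_depth_null h x v).trans_le (Nat.lt_succ_iff.1 hd)⟩, rfl⟩))

theorem isTermOver_of_mem_chase {β : Atom P (GTerm C P V)} (hβ : β ∈ chase D Γ) :
    ∀ t ∈ β.args, IsTermOver D Γ t := by
  refine chase_induction (p := fun β => ∀ t ∈ β.args, IsTermOver D Γ t) ?_ ?_ hβ
  · intro α hα t ht
    obtain ⟨c, hc, rfl⟩ := List.mem_map.1 ht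
    exact .const hα hc
  · intro σ h ht hb α hα t hm
    obtain ⟨v, hv, rfl⟩ := List.mem_map.1 hm
    have hvh := mem_headVars.2 ⟨α, hα, hv⟩
    rw [headAssignment]
    split_ifs with hf
    · exact hb _ (List.mem_map_of_mem (mem_frontier.1 hf).1)
    · exact .null ht.1 hvh fun w => hb _ (List.mem_map_of_mem (mem_frontier.1 w.2).1)

/-- An atom not coming from `D` copies predicate and arity from a head atom and takes its arguments
from a finite set of terms. -/
theorem chase_finite_of_depth_lt {n : ℕ}
    (hn : ∀ β ∈ chase D Γ, ∀ t ∈ β.args, t.depth < n) : (chase D Γ).Finite := by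
  have h1 : ((fun α : Atom P C => α.map (GTerm.const : C → GTerm C P V)) '' D).Finite :=
    D.finite_toSet.image _
  have h2 : (⋃ σ ∈ Γ, ⋃ α ∈ σ.head, (Atom.mk α.pred) ''
      {l : List (GTerm C P V) | l.length = α.args.length ∧
        ∀ t ∈ l, t ∈ {t | IsTermOver D Γ t ∧ t.depth < n}}).Finite :=
    Γ.finite_toSet.biUnion fun σ _ => σ.head.finite_toSet.biUnion fun α _ =>
      (finite_lists_of_length (finite_terms_of_depth_lt n) _).image _
  refine (h1.union h2).subset fun β hβ => ?_
  have hβ' := fun t ht => And.intro (isTermOver_of_mem_chase hβ t ht) (hn β hβ t ht)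
  obtain ⟨i, hi⟩ := Set.mem_iUnion.1 hβ
  induction i with
  | zero =>
    obtain ⟨α, hα, rfl⟩ := hi
    exact Or.inl ⟨α, hα, rfl⟩
  | succ i ih =>
    rcases hi with hi | ⟨σ, h, ht, α, hα, rfl⟩
    · exact ih hi
    · exact Or.inr (Set.mem_biUnion ht.1 (Set.mem_biUnion hα
        ⟨_, ⟨by simp [Atom.map], hβ'⟩, rfl⟩))

theorem exists_depth_lt_of_chase_finite (hfin : (chase D Γ).Finite) :
    ∃ n, ∀ β ∈ chase D Γ, ∀ t ∈ β.args, t.depth < n := by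
  have h1 : (⋃ β ∈ chase D Γ, GTerm.depth '' {t | t ∈ β.args}).Finite :=
    hfin.biUnion fun β _ => β.args.finite_toSet.image _
  obtain ⟨n, hn⟩ := h1.bddAbove
  exact ⟨n + 1, fun β hβ t ht => Nat.lt_succ_iff.2 (hn (Set.mem_biUnion hβ ⟨t, ht, rfl⟩))⟩

end Terms

/-! ### Terms moving along dependency edges. -/

section Positions

variable {C P V : Type*} [DecidableEq V] [DecidableEq (GTerm C P V)]
  {D : Finset (Atom P C)} {Γ : Finset (LinearTGD P V)}

/-- The term `t` occurs at the position `u` of the simplification of the atom `β`. -/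
def OccursAt (β : Atom P (GTerm C P V)) (u : Shape P × ℕ) (t : GTerm C P V) : Prop :=
  β.simple.pred = u.1 ∧ β.simple.args[u.2]? = some t

theorem OccursAt.mem {β : Atom P (GTerm C P V)} {u : Shape P × ℕ} {t : GTerm C P V}
    (h : OccursAt β u t) : t ∈ β.args :=
  mem_unique.1 (List.mem_of_getElem? h.2)

variable [DecidableEq P]

theorem occursAt_of_simple_eq {β : Atom P (GTerm C P V)} {α : Atom (Shape P) V}
    {g : V → GTerm C P V} (h : β.simple = α.map g) {x : V} {u : Shape P × ℕ} (hu : u ∈ α.posVar x) :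
    OccursAt β u (g x) := by
  obtain ⟨h1, h2⟩ := mem_posVar.1 hu
  rw [OccursAt, h]
  exact ⟨h1, by simp [Atom.map, h2]⟩

theorem termAssignment_lt_of_mem_exVars {σ : LinearTGD P V} {h : V → GTerm C P V} {x z : V}
    (hx : x ∈ (σ.simplify (hSpecialization σ.body.args h)).frontier)
    (hz : z ∈ (σ.simplify (hSpecialization σ.body.args h)).exVars) :
    (termAssignment σ h x).depth < (termAssignment σ h z).depth := by
  obtain ⟨hxb, hxh⟩ := mem_frontier.1 hx
  obtain ⟨hzh, hzb⟩ := mem_exVars.1 hz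
  obtain ⟨v, hv, rfl⟩ := mem_simplify_body.1 hxb
  obtain ⟨α, hα, w, hw, hwx⟩ := exists_mem_simplify_head.1 hxh
  obtain ⟨α', hα', y, hy, rfl⟩ := exists_mem_simplify_head.1 hzh
  have hyb : y ∉ σ.body.args := fun hyb => hzb (mem_simplify_body.2 ⟨y, hyb, rfl⟩)
  -- The representative `x` need not itself occur in the head of `σ`, but some `w` identified with
  -- it does. This `w` is in the body, since variables outside it are fixed by the specialization.
  have hwb : w ∈ σ.body.args := by
    by_contra hwb
    rw [hSpecialization_of_notMem h hwb] at hwx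
    exact hwb (hwx ▸ hSpecialization_mem h hv)
  rw [← hwx, termAssignment_hSpecialization_of_mem σ h hwb,
    termAssignment_hSpecialization_of_notMem σ h hyb]
  exact GTerm.depth_lt_depth_null (fun v => h v.1) y ⟨w, mem_frontier.2 ⟨hwb, α, hα, hw⟩⟩

variable [DecidableEq C]

/-- An atom of the chase whose shape is the body predicate of a simplified TGD `τ` is the image of
the body of `τ`, and the chase contains the images of the head atoms. -/
theorem exists_trigger_of_pred_eq {τ : LinearTGD (Shape P) V} (hτ : τ ∈ dynSimplification D Γ)
    {β : Atom P (GTerm C P V)} (hβ : β ∈ chase D Γ) (hs : β.simple.pred = τ.body.pred) :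
    ∃ g : V → GTerm C P V, β.simple = τ.body.map g ∧
      (∀ α ∈ τ.head, ∃ γ ∈ chase D Γ, γ.simple = α.map g) ∧
      ∀ x ∈ τ.frontier, ∀ z ∈ τ.exVars, (g x).depth < (g z).depth := by
  obtain ⟨σ, h, ht, rfl⟩ := mem_dynSimplification.1 hτ
  -- The trigger that put `τ` into the output may use another atom than `β`. Equal shapes move it to
  -- a trigger on `β` with the same specialization, hence with the same `τ`.
  have hs' : (σ.body.map h).shape = β.shape :=
    (congrArg Atom.pred (body_simple_map_termAssignment σ h)).trans hs.symm
  obtain ⟨h', rfl, he⟩ := exists_map_eq_of_shape_eq (fun v => ⟨h v⟩) hs'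
  rw [← he]
  refine ⟨termAssignment σ h', body_simple_map_termAssignment σ h', ?_, fun x hx z hz =>
    termAssignment_lt_of_mem_exVars hx hz⟩
  intro α' hα'
  obtain ⟨α, hα, rfl⟩ := Finset.mem_image.1 hα'
  exact ⟨_, map_headAssignment_mem_chase ⟨ht.1, hβ⟩ hα, head_simple_map_termAssignment h' hα⟩

theorem exists_occursAt_of_special {u v : Shape P × ℕ}
    (huv : (u, v) ∈ (buildDepGraph (dynSimplification D Γ)).special)
    {β : Atom P (GTerm C P V)} (hβ : β ∈ chase D Γ) {t : GTerm C P V} (ht : OccursAt β u t) :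
    ∃ γ ∈ chase D Γ, ∃ t', OccursAt γ v t' ∧ t.depth < t'.depth := by
  obtain ⟨τ, hτ, x, hx, hu, z, hz, α, hα, hv⟩ := mem_special_buildDepGraph.1 huv
  obtain ⟨g, hb, hh, hlt⟩ := exists_trigger_of_pred_eq hτ hβ (ht.1.trans (mem_posVar.1 hu).1.symm)
  obtain ⟨γ, hγ, hγα⟩ := hh α hα
  have htx : g x = t := Option.some_injective _ ((occursAt_of_simple_eq hb hu).2.symm.trans ht.2)
  exact ⟨γ, hγ, g z, occursAt_of_simple_eq hγα hv, htx ▸ hlt x hx z hz⟩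

theorem exists_occursAt_of_normal {u v : Shape P × ℕ}
    (huv : (u, v) ∈ (buildDepGraph (dynSimplification D Γ)).normal)
    {β : Atom P (GTerm C P V)} (hβ : β ∈ chase D Γ) {t : GTerm C P V} (ht : OccursAt β u t) :
    ∃ γ ∈ chase D Γ, OccursAt γ v t := by
  obtain ⟨τ, hτ, x, hx, hu, α, hα, hv⟩ := mem_normal_buildDepGraph.1 huv
  obtain ⟨g, hb, hh, -⟩ := exists_trigger_of_pred_eq hτ hβ (ht.1.trans (mem_posVar.1 hu).1.symm)
  obtain ⟨γ, hγ, hγα⟩ := hh α hα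
  have htx : g x = t := Option.some_injective _ ((occursAt_of_simple_eq hb hu).2.symm.trans ht.2)
  exact ⟨γ, hγ, htx ▸ occursAt_of_simple_eq hγα hv⟩

theorem exists_occursAt_of_reflTransGen {u v : Shape P × ℕ} {A : Finset (Shape P × ℕ)}
    (huv : Relation.ReflTransGen ((buildDepGraph (dynSimplification D Γ)).EdgeIn A) u v)
    {β : Atom P (GTerm C P V)} (hβ : β ∈ chase D Γ) {t : GTerm C P V} (ht : OccursAt β u t) :
    ∃ γ ∈ chase D Γ, ∃ t', OccursAt γ v t' ∧ t.depth ≤ t'.depth := by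
  induction huv with
  | refl => exact ⟨β, hβ, t, ht, le_rfl⟩
  | tail _ h ih =>
    obtain ⟨γ, hγ, t', ht', hle⟩ := ih
    rcases h.2.2 with h | h
    · obtain ⟨δ, hδ, hδt⟩ := exists_occursAt_of_normal h hγ ht'
      exact ⟨δ, hδ, t', hδt, hle⟩
    · obtain ⟨δ, hδ, t'', hδt, hlt⟩ := exists_occursAt_of_special h hγ ht'
      exact ⟨δ, hδ, t'', hδt, hle.trans hlt.le⟩

/-- Here reachability from `D` enters: `τ` stems from an actual trigger, so its body positions are
occupied in the chase. -/
theorem exists_occursAt_source {u v : Shape P × ℕ}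
    (huv : (u, v) ∈ (buildDepGraph (dynSimplification D Γ)).special) :
    ∃ β ∈ chase D Γ, ∃ t : GTerm C P V, OccursAt β u t := by
  obtain ⟨τ, hτ, x, -, hu, -⟩ := mem_special_buildDepGraph.1 huv
  obtain ⟨σ, h, ht, rfl⟩ := mem_dynSimplification.1 hτ
  exact ⟨_, ht.2, _, occursAt_of_simple_eq (body_simple_map_termAssignment σ h) hu⟩

/-- A special edge on a cycle produces terms of unbounded depth. -/
theorem chase_infinite_of_special_cycle {u v : Shape P × ℕ} {A : Finset (Shape P × ℕ)}
    (huv : (u, v) ∈ (buildDepGraph (dynSimplification D Γ)).special)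
    (hvu : Relation.ReflTransGen ((buildDepGraph (dynSimplification D Γ)).EdgeIn A) v u) :
    ¬ (chase D Γ).Finite := by
  intro hfin
  obtain ⟨n, hn⟩ := exists_depth_lt_of_chase_finite hfin
  -- Each turn around the cycle returns to `u` with a term at least one level deeper.
  have key : ∀ k, ∃ β ∈ chase D Γ, ∃ t : GTerm C P V, OccursAt β u t ∧ k ≤ t.depth := by
    intro k
    induction k with
    | zero =>
      obtain ⟨β, hβ, t, ht⟩ := exists_occursAt_source huv
      exact ⟨β, hβ, t, ht, Nat.zero_le _⟩
    | succ k ih =>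
      obtain ⟨β, hβ, t, ht, hk⟩ := ih
      obtain ⟨γ, hγ, t', ht', hlt⟩ := exists_occursAt_of_special huv hβ ht
      obtain ⟨δ, hδ, t'', ht'', hle⟩ := exists_occursAt_of_reflTransGen hvu hγ ht'
      exact ⟨δ, hδ, t'', ht'', (hk.trans_lt hlt).trans_le hle⟩
  obtain ⟨β, hβ, t, ht, hle⟩ := key n
  exact (hn β hβ t ht.mem).not_ge hle

/-- The depth of a term is bounded by the rank of each position at which it occurs. -/
theorem depth_le_rank {r : Shape P × ℕ → ℕ}
    (hr : ∀ u v, (u, v) ∈ (buildDepGraph (dynSimplification D Γ)).normal → r u ≤ r v)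
    (hr' : ∀ u v, (u, v) ∈ (buildDepGraph (dynSimplification D Γ)).special → r u < r v)
    {β : Atom P (GTerm C P V)} (hβ : β ∈ chase D Γ) :
    ∀ u t, OccursAt β u t → t.depth ≤ r u := by
  refine chase_induction (p := fun β => ∀ u t, OccursAt β u t → t.depth ≤ r u) ?_ ?_ hβ
  · intro α hα u t ht
    obtain ⟨c, -, rfl⟩ := List.mem_map.1 ht.mem
    simp [GTerm.depth]
  · intro σ h ht hb α hα v t hv
    have hτ := mem_dynSimplification.2 ⟨σ, h, ht, rfl⟩
    have hbody : ∀ x u, u ∈ (σ.simplify (hSpecialization σ.body.args h)).body.posVar x →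
        (termAssignment σ h x).depth ≤ r u := fun x u hu =>
      hb u _ (occursAt_of_simple_eq (body_simple_map_termAssignment σ h) hu)
    have hα' : (α.map (hSpecialization σ.body.args h)).simple ∈
        (σ.simplify (hSpecialization σ.body.args h)).head := Finset.mem_image_of_mem _ hα
    obtain ⟨h1, h2⟩ := hv
    rw [head_simple_map_termAssignment h hα] at h1 h2
    simp only [Atom.map, List.getElem?_map, Option.map_eq_some_iff] at h2
    obtain ⟨y, hy, rfl⟩ := h2
    have hyv : v ∈ (α.map (hSpecialization σ.body.args h)).simple.posVar y :=
      mem_posVar.2 ⟨h1, hy⟩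
    have hyh := List.mem_of_getElem? hy
    by_cases hyb : y ∈ (σ.simplify (hSpecialization σ.body.args h)).body.args
    · obtain ⟨u, hu⟩ := exists_mem_posVar hyb
      exact (hbody y u hu).trans (hr u v (mem_normal_buildDepGraph.2
        ⟨_, hτ, y, mem_frontier.2 ⟨hyb, _, hα', hyh⟩, hu, _, hα', hyv⟩))
    · obtain ⟨w, hw, hwy⟩ := List.mem_map.1 (mem_unique.1 hyh)
      have hwb : w ∉ σ.body.args := fun hwb => hyb (mem_simplify_body.2 ⟨w, hwb, hwy⟩)
      rw [← hwy, termAssignment_hSpecialization_of_notMem σ h hwb, GTerm.depth]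
      -- Each frontier variable of `σ` yields a special edge into `v`, whose strict rank increase
      -- absorbs the `+ 1` in the depth. With an empty frontier there is no such edge, and the depth
      -- is `0`.
      refine Finset.sup_le fun x _ => ?_
      obtain ⟨hxb, α₁, hα₁, hxα₁⟩ := mem_frontier.1 x.2
      have hxb' := mem_simplify_body.2
        ⟨x.1, hxb, (rfl : hSpecialization σ.body.args h x.1 = _)⟩
      obtain ⟨u, hu⟩ := exists_mem_posVar hxb'
      have hle := hbody _ u hu
      rw [termAssignment_hSpecialization_of_mem σ h hxb] at hle
      exact (Nat.succ_le_succ hle).trans (hr' u v (mem_special_buildDepGraph.2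
        ⟨_, hτ, _, mem_frontier.2 ⟨hxb', exists_mem_simplify_head.2 ⟨α₁, hα₁, x.1, hxα₁, rfl⟩⟩, hu,
          y, mem_exVars.2 ⟨⟨_, hα', hyh⟩, hyb⟩, _, hα', hyv⟩))

end Positions

end Chase

theorem lemma4p5 {C P V : Type*} [DecidableEq C] [DecidableEq P] [DecidableEq V]
    (D : Finset (Chase.Atom P C)) (Γ : Finset (Chase.LinearTGD P V)) :
    Chase.isChaseFinite D Γ = true ↔ (Chase.chase D Γ).Finite := by
  -- Shapes of chase atoms require decidable equality of terms with nulls.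
  classical
  have hiff : Chase.isChaseFinite D Γ = true ↔
      Chase.findSpecialSCC (Chase.buildDepGraph (Chase.dynSimplification D Γ)) = ∅ := by
    simp [Chase.isChaseFinite]
  rw [hiff, Chase.findSpecialSCC_eq_empty_iff Chase.special_subset_nodes]
  constructor
  · intro h
    obtain ⟨r, hr, hr', hcard⟩ := Chase.exists_rank Chase.special_subset_nodes
      Chase.normal_subset_nodes h
    refine Chase.chase_finite_of_depth_lt
      (n := (Chase.buildDepGraph (Chase.dynSimplification D Γ)).nodes.card + 1)
      fun β hβ t ht => Nat.lt_succ_iff.2 ?_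
    obtain ⟨i, hi⟩ := List.mem_iff_getElem?.1 (Chase.mem_unique.2 ht)
    exact (Chase.depth_le_rank hr hr' hβ (β.shape, i) t ⟨rfl, hi⟩).trans (hcard _)
  · rintro hfin ⟨u, v⟩ huv hvu
    exact Chase.chase_infinite_of_special_cycle huv hvu hfin
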